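/- **Setting.** A Markov pseudo-game has $n$ players; a nonempty compact state space $S\subseteq\mathbb R^\ell$; for each player $i$ a nonempty compact action space $A_i\subseteq\mathbb R^m$, with $A=\prod_i A_i$ and $A_{-i}=\prod_{j\ne i}A_j$; feasible-action correspondences $X_i:S\times A_{-i}\rightrightarrows A_i$; bounded rewards $r_i:S\times A\to\mathbb R$ that are continuous in the state and in the action profile separately; a Markov transition kernel $\rho(\cdot\mid s,a)$ on $S$; a discount factor $\gamma\in(0,1)$; and an initial state distribution. A policy of player $i$ is a measurable map from histories $((s_0,a_0),\dots,(s_{\tau-1},a_{\tau-1}),s_\tau)$, $\tau\ge 0$, to $A_i$; it is Markov if it depends only on the current state $s_\tau$. For a policy profile $\pi$, $$V_i^\pi(s)=\mathbb E^\pi\Big[\sum_{t\ge0}\gamma^t r_i(s_t,a_t)\,\Big|\,s_0=s\Big],\qquad Q_i^\pi(s,a)=r_i(s,a)+\gamma\int V_i^\pi(s')\,\rho(ds'\mid s,a).$$ A Markov policy profile $\pi$ is feasible if $\pi_i(s)\in X_i(s,\pi_{-i}(s))$ for all $i,s$. A feasible Markov policy profile $\pi$ is a generalized Markov perfect equilibrium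 (GMPE) if $V_i^{\pi}(s)\ge V_i^{(\pi_i',\pi_{-i})}(s)$ for every state $s$, every player $i$ and every (possibly history-dependent) policy $\pi_i'$ of player $i$ with $\pi_i'(h)\in X_i(s_\tau,\pi_{-i}(s_\tau))$ at every history $h$ with final state $s_\tau$. For $f:A_i\to\mathbb R$ and $a\in A_i$ the superdifferential is $\partial f(a)=\{v\in\mathbb R^m: f(x)\le f(a)+\langle v,x-a\rangle\ \forall x\in A_i\}$; $\partial_{a_i}$ denotes the superdifferential in the action of player $i$. **Theorem.** Suppose that there are functions $g_{ic}:S\times A\to\mathbb R$, $c=1,\dots,d$, concave in $a_i\in A_i$ (in particular $A_i$ is convex if $d\ge1$), such that $$X_i(s,a_{-i})=\{a_i\in A_i: g_{ic}(s,a_i,a_{-i})\ge 0\ \text{for all } c\}$$ for all $i$, $s$, $a_{-i}$. Let $\pi$ be a feasible Markov policy profile. Consider the following system in $\lambda:S\to\mathbb R_+^{n\times d}$: for all players $i$ and states $s$, $$0\in\partial_{a_i}Q_i^\pi(s,\pi_i(s),\pi_{-i}(s))+\sum_{c}\lambda_{ic}(s)\,\partial_{a_i}g_{ic}(s,\pi_i(s),\pi_{-i}(s)),$$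 $$\lambda_{ic}(s)\,g_{ic}(s,\pi(s))=0\quad\text{and}\quad g_{ic}(s,\pi(s))\ge0\quad\text{for all }c,$$ $$V_i^\pi(s)=Q_i^\pi(s,\pi(s)),$$ where terms with $\lambda_{ic}(s)=0$ are omitted from the sum (that is, $0\cdot\partial g=\{0\}$, also when $\partial g=\emptyset$). 1. If some $\lambda:S\to\mathbb R_+^{n\times d}$ solves the system, then $\pi$ is a GMPE. 2. Suppose moreover that, for all $i$ and $s$, the set $A_i$ is convex, the map $a_i\mapsto Q_i^\pi(s,a_i,\pi_{-i}(s))$ is concave on $A_i$, and Slater's condition holds: some $\bar a_i$ in the relative interior of $A_i$ satisfies $g_{ic}(s,\bar a_i,\pi_{-i}(s))\ge0$ for all $c$, with strict inequality for every $c$ for which $a_i\mapsto g_{ic}(s,a_i,\pi_{-i}(s))$ is not affine on $A_i$. Then $\pi$ is a GMPE if and only if some $\lambda:S\to\mathbb R_+^{n\times d}$ solves the system. -/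

import Mathlib

open MeasureTheory ProbabilityTheory
open scoped NNReal

/-- An infinite-horizon discounted Markov pseudo-game with `n` players, states in `ℝ^ℓ` and
actions in `ℝ^m`. States and actions are elements of the subtypes of `State` and `Act i`, with
their Borel σ-algebras; an action profile is an element of `∀ i, Act i`. -/
structure MarkovPseudoGame (n ℓ m : ℕ) where
  /-- the state space -/
  State : Set (EuclideanSpace ℝ (Fin ℓ))
  /-- the action space of each player -/
  Act : Fin n → Set (EuclideanSpace ℝ (Fin m))
  state_nonempty : State.Nonempty
  state_compact : IsCompact State
  act_nonempty : ∀ i, (Act i).Nonempty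
  act_compact : ∀ i, IsCompact (Act i)
  /-- feasible actions of player `i`, given the state and the actions of the other players -/
  feasible : ∀ i, State → (∀ j : {j : Fin n // j ≠ i}, Act j) → Set (Act i)
  /-- `reward s a i` is the reward of player `i` -/
  reward : State → (∀ i, Act i) → Fin n → ℝ
  reward_continuous_state : ∀ a i, Continuous fun s => reward s a i
  reward_continuous_act : ∀ s i, Continuous fun a => reward s a i
  reward_bounded : ∃ B : ℝ, ∀ s a i, |reward s a i| ≤ B
  /-- `transition (s, a)` is the law of the next state -/
  transition : Kernel (State × (∀ i, Act i)) State
  transition_markov : IsMarkovKernel transition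
  /-- the discount factor -/
  discount : ℝ
  discount_pos : 0 < discount
  discount_lt_one : discount < 1
  /-- the law of the initial state -/
  initial : ProbabilityMeasure State

namespace MarkovPseudoGame

variable {n ℓ m : ℕ} (M : MarkovPseudoGame n ℓ m)

/-- Action profiles. -/
abbrev Profile : Type := ∀ i, M.Act i

/-- Histories of length `τ`: the `τ` past state-action pairs and the current state. -/
abbrev History (τ : ℕ) : Type := (Fin τ → M.State × M.Profile) × M.State

/-- The actions of the players other than `i`. -/
def others (i : Fin n) (a : M.Profile) : ∀ j : {j : Fin n // j ≠ i}, M.Act j := fun j => a j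

/-- A (deterministic, measurable, possibly history-dependent) policy of player `i`. -/
structure Policy (i : Fin n) where
  act : ∀ τ, M.History τ → M.Act i
  measurable_act : ∀ τ, Measurable (act τ)

/-- A (deterministic, measurable) Markov policy of player `i`. -/
structure MarkovPolicy (i : Fin n) where
  act : M.State → M.Act i
  measurable_act : Measurable act

variable {M}

/-- A Markov policy, as a policy that only looks at the current state. -/
def MarkovPolicy.toPolicy {i : Fin n} (p : M.MarkovPolicy i) : M.Policy i where
  act := fun _ h => p.act h.2
  measurable_act := fun _ => p.measurable_act.comp measurable_snd

/-- The action profile that a policy profile prescribes after a history. -/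
def play (p : ∀ i, M.Policy i) (τ : ℕ) (h : M.History τ) : M.Profile := fun i => (p i).act τ h

/-- The action profile that a Markov policy profile prescribes at a state. -/
def markovPlay (p : ∀ i, M.MarkovPolicy i) (s : M.State) : M.Profile := fun i => (p i).act s

/-- The policy profile given by a Markov policy profile. -/
def markovProfile (p : ∀ i, M.MarkovPolicy i) : ∀ i, M.Policy i := fun i => (p i).toPolicy

theorem measurable_play (p : ∀ i, M.Policy i) (τ : ℕ) : Measurable (play p τ) :=
  measurable_pi_lambda _ fun i => (p i).measurable_act τ

/-- The history of length `t + 1` formed by the state-action pairs of times `0, …, t` and the state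
at time `t + 1`. -/
def extendHistory (t : ℕ) (x : (Finset.Iic t → M.State × M.Profile) × M.State) :
    M.History (t + 1) :=
  (fun k => x.1 ⟨k, Finset.mem_Iic.2 (Nat.le_of_lt_succ k.isLt)⟩, x.2)

theorem measurable_extendHistory (t : ℕ) : Measurable (extendHistory (M := M) t) :=
  (measurable_pi_lambda _ fun _ => (measurable_pi_apply _).comp measurable_fst).prodMk
    measurable_snd

/-- One step of play: given the state-action pairs up to time `t`, the state at time `t + 1` is
drawn from the transition kernel at the pair of time `t`, and the players then act according to
their policies. -/
noncomputable def stepKernel (p : ∀ i, M.Policy i) (t : ℕ) :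
    Kernel (Finset.Iic t → M.State × M.Profile) (M.State × M.Profile) :=
  (Kernel.id ×ₖ M.transition.comap (fun x => x ⟨t, Finset.mem_Iic.2 le_rfl⟩)
    (measurable_pi_apply _)).map fun x => (x.2, play p (t + 1) (extendHistory t x))

instance (p : ∀ i, M.Policy i) (t : ℕ) : IsMarkovKernel (stepKernel p t) := by
  have := M.transition_markov
  exact Kernel.IsMarkovKernel.map _
    (measurable_snd.prodMk ((measurable_play p (t + 1)).comp (measurable_extendHistory t)))

/-- The law of the infinite sequence of state-action pairs when play starts at `s` and the policy
profile `p` is followed. -/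
noncomputable def trajectory (p : ∀ i, M.Policy i) (s : M.State) :
    Measure (ℕ → M.State × M.Profile) :=
  Kernel.traj (X := fun _ => M.State × M.Profile) (stepKernel p) 0
    (fun _ => (s, play p 0 (Fin.elim0, s)))

/-- The state-value function: the expected discounted sum of the rewards of player `i`. -/
noncomputable def value (p : ∀ i, M.Policy i) (i : Fin n) (s : M.State) : ℝ :=
  ∫ ω, ∑' t : ℕ, M.discount ^ t * M.reward (ω t).1 (ω t).2 i ∂(trajectory p s)

/-- The action-value function. -/
noncomputable def actionValue (p : ∀ i, M.Policy i) (i : Fin n) (s : M.State) (a : M.Profile) : ℝ :=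
  M.reward s a i + M.discount * ∫ x, value p i x ∂(M.transition (s, a))

/-- `q` is a feasible policy of player `i` against the policies in `p` of the other players. -/
def IsFeasiblePolicy (p : ∀ i, M.Policy i) (i : Fin n) (q : M.Policy i) : Prop :=
  ∀ (τ : ℕ) (h : M.History τ), q.act τ h ∈ M.feasible i h.2 (M.others i (play p τ h))

/-- A Markov policy profile each of whose components is feasible against the others. -/
def IsFeasibleMarkov (p : ∀ i, M.MarkovPolicy i) : Prop :=
  ∀ i s, (p i).act s ∈ M.feasible i s (M.others i (markovPlay p s))

/-- Generalized Markov perfect equilibrium: a feasible Markov policy profile such that, from no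
state, a player gains by deviating to a feasible, possibly history-dependent, policy. -/
def IsGMPE (p : ∀ i, M.MarkovPolicy i) : Prop :=
  IsFeasibleMarkov p ∧
    ∀ (i : Fin n) (s : M.State) (q : M.Policy i), IsFeasiblePolicy (markovProfile p) i q →
      value (Function.update (markovProfile p) i q) i s ≤ value (markovProfile p) i s

end MarkovPseudoGame

section Concave

variable {E : Type*} [NormedAddCommGroup E] [InnerProductSpace ℝ E] {K : Set E}

/-- Concavity of a function that is defined on a subset `K` only (part of it: `K` is convex). -/
def IsConcave (f : K → ℝ) : Prop := ConcaveOn ℝ K (Function.extend Subtype.val f 0)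

/-- The function `f` on `K` is the restriction of an affine function. -/
def IsAffine (f : K → ℝ) : Prop := ∃ (v : E) (b : ℝ), ∀ x : K, f x = inner ℝ v (x : E) + b

/-- The superdifferential at `a` of a function on `K`. -/
def superdiff (f : K → ℝ) (a : K) : Set E :=
  {v | ∀ x : K, f x ≤ f a + inner ℝ v ((x : E) - (a : E))}

end Concave

namespace MarkovPseudoGame

variable {n ℓ m d : ℕ} {M : MarkovPseudoGame n ℓ m}

/-- A function of the action profile, as a function of the action of player `i` alone. -/
def slice (i : Fin n) (a : M.Profile) (F : M.Profile → ℝ) : M.Act i → ℝ :=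
  fun x => F (Function.update a i x)

/-- The feasible sets are given by the concave inequality constraints `g i c ≥ 0`, `c = 1, …, d`. -/
def ConcaveConstraints (M : MarkovPseudoGame n ℓ m)
    (g : Fin n → Fin d → M.State → M.Profile → ℝ) : Prop :=
  ∀ (i : Fin n) (s : M.State) (a : M.Profile),
    M.feasible i s (M.others i a) = {x | ∀ c, 0 ≤ slice i a (g i c s) x} ∧
      ∀ c, IsConcave (slice i a (g i c s))

/-- Concavity, at every state, of the action value of each player in that player's own action. -/
def ConcaveActionValue (p : ∀ i, M.MarkovPolicy i) : Prop :=
  ∀ (i : Fin n) (s : M.State),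
    IsConcave (slice i (markovPlay p s) (actionValue (markovProfile p) i s))

/-- Slater's condition, with non-strict inequalities for affine constraints, in the
maximization problem of every player at every state. -/
def SlaterCondition (g : Fin n → Fin d → M.State → M.Profile → ℝ) (p : ∀ i, M.MarkovPolicy i) :
    Prop :=
  ∀ (i : Fin n) (s : M.State), ∃ x : M.Act i,
    (x : EuclideanSpace ℝ (Fin m)) ∈ intrinsicInterior ℝ (M.Act i) ∧
      ∀ c, 0 ≤ slice i (markovPlay p s) (g i c s) x ∧
        (¬ IsAffine (slice i (markovPlay p s) (g i c s)) →
          0 < slice i (markovPlay p s) (g i c s) x)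

/-- `0 ∈ ∂ Q + ∑ c, μ c • ∂ g c` at the action of player `i`. A constraint with a zero multiplier
contributes `0`, also when its superdifferential is empty. -/
def Stationary (g : Fin n → Fin d → M.State → M.Profile → ℝ) (p : ∀ i, M.MarkovPolicy i)
    (i : Fin n) (s : M.State) (μ : Fin d → ℝ≥0) : Prop :=
  ∃ (v : EuclideanSpace ℝ (Fin m)) (w : Fin d → EuclideanSpace ℝ (Fin m)),
    v ∈ superdiff (slice i (markovPlay p s) (actionValue (markovProfile p) i s)) ((p i).act s) ∧
    (∀ c, μ c ≠ 0 → w c ∈ superdiff (slice i (markovPlay p s) (g i c s)) ((p i).act s)) ∧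
    v + ∑ c, (μ c : ℝ) • w c = 0

/-- The first-order conditions of all players at all states, with multiplier policy `μ`, together
with the Bellman equation. -/
def SolvesKKTBellman (g : Fin n → Fin d → M.State → M.Profile → ℝ) (p : ∀ i, M.MarkovPolicy i)
    (μ : M.State → Fin n → Fin d → ℝ≥0) : Prop :=
  ∀ (i : Fin n) (s : M.State),
    Stationary g p i s (μ s i) ∧
    (∀ c, (μ s i c : ℝ) * g i c s (markovPlay p s) = 0) ∧
    (∀ c, 0 ≤ g i c s (markovPlay p s)) ∧
    value (markovProfile p) i s = actionValue (markovProfile p) i s (markovPlay p s)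

end MarkovPseudoGame

/-! Both claims rest on the one-shot deviation principle (`isGMPE_iff_actionValue_le`): a feasible
Markov profile is an equilibrium exactly when, at each state, each player's action maximizes the
action value over that player's feasible actions. Summing advantages along the deviating trajectory
(`hasSum_advantage`) gives this principle, because the gain from a deviation is a discounted sum of
expected advantages. What remains is a separate static program for each player and state. The
Bellman equation in the system holds for every Markov profile (`value_markovProfile`).

Sufficiency is then immediate: supergradient inequalities are global, so stationarity with
complementary slackness yields a maximum without concavity of the action value
(`Stationary.actionValue_le`).

Necessity is a Karush-Kuhn-Tucker theorem with weak Slater condition. Separation gives Fritz John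
multipliers. If the objective's weight is zero, the constraints with positive weight are affine and
have a combination that vanishes identically; one of them is turned into an equality, and induction
applies (`exists_lagrange_multipliers`). Supergradients of the individual functions come from giving
each constraint its own copy of the variable: they are read off the multipliers of the equations
between copies (`exists_superdifferential_multipliers`). -/

section ConvexProgram

/-! ### Lagrange multipliers for concave programs. -/

open Filter Topology

variable {V : Type*} [AddCommGroup V] [Module ℝ V]

/-- A theorem of the alternative: if finitely many concave functions are nowhere positive
simultaneously, then some nontrivial nonnegative combination of them is nonpositive. -/
theorem exists_nonneg_combination_nonpos {ι : Type*} [Fintype ι] {C : Set V} (hne : C.Nonempty)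
    {f : ι → V → ℝ} (hC : Convex ℝ C) (hf : ∀ i, ConcaveOn ℝ C (f i))
    (h : ¬ ∃ y ∈ C, ∀ i, 0 < f i y) :
    ∃ θ : ι → ℝ, (∀ i, 0 ≤ θ i) ∧ (∃ i, θ i ≠ 0) ∧ ∀ y ∈ C, ∑ i, θ i * f i y ≤ 0 := by
  classical
  set S : Set (ι → ℝ) := {u | ∃ y ∈ C, ∀ i, u i < f i y} with hS
  -- The strict inequality makes `S` open, so it can be separated from `0` without closedness or
  -- interior assumptions on `C`.
  have hSo : IsOpen S := by
    have : S = ⋃ y ∈ C, Set.pi Set.univ fun i => Set.Iio (f i y) := by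
      ext u; simp [hS]
    rw [this]
    exact isOpen_biUnion fun y _ => isOpen_set_pi Set.finite_univ fun i _ => isOpen_Iio
  have hSc : Convex ℝ S := by
    rintro u ⟨y, hy, hu⟩ v ⟨z, hz, hv⟩ a b ha hb hab
    refine ⟨a • y + b • z, hC hy hz ha hb hab, fun i => ?_⟩
    refine lt_of_lt_of_le ?_ ((hf i).2 hy hz ha hb hab)
    simp only [Pi.add_apply, Pi.smul_apply, smul_eq_mul]
    rcases ha.eq_or_lt with rfl | ha
    · obtain rfl : b = 1 := by linarith
      simpa using hv i
    · have h1 := mul_lt_mul_of_pos_left (hu i) ha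
      have h2 := mul_le_mul_of_nonneg_left (hv i).le hb
      linarith
  have h0 : (0 : ι → ℝ) ∉ S := fun ⟨y, hy, hu⟩ => h ⟨y, hy, hu⟩
  obtain ⟨φ, hφ⟩ := geometric_hahn_banach_open_point hSc hSo h0
  rw [map_zero] at hφ
  have hsum (u : ι → ℝ) : φ u = ∑ i, φ (Pi.single i 1) * u i := by
    have := LinearMap.pi_apply_eq_sum_univ (φ : (ι → ℝ) →ₗ[ℝ] ℝ) u
    simp only [ContinuousLinearMap.coe_coe, smul_eq_mul] at this
    rw [this]
    refine Finset.sum_congr rfl fun i _ => ?_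
    rw [mul_comm]
    congr 2
    ext j
    simp [Pi.single_apply, eq_comm]
  obtain ⟨y₀, hy₀⟩ := hne
  have hmem : (fun i => f i y₀ - 1) ∈ S := ⟨y₀, hy₀, fun i => by linarith⟩
  have hneg := hφ _ hmem
  set u₀ : ι → ℝ := fun i => f i y₀ - 1
  have hpos (i : ι) : 0 ≤ φ (Pi.single i 1) := by
    by_contra! hi
    -- `S` is closed under decreasing coordinates. With `φ (Pi.single i 1) < 0`, decreasing
    -- coordinate `i` of `u₀` by this amount reaches `φ = 0`, which is impossible on `S`.
    have ht : 0 < φ u₀ / φ (Pi.single i 1) := div_pos_of_neg_of_neg hneg hi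
    have hm : u₀ - (φ u₀ / φ (Pi.single i 1)) • Pi.single i 1 ∈ S := by
      refine ⟨y₀, hy₀, fun j => ?_⟩
      have : 0 ≤ (Pi.single i (1 : ℝ) : ι → ℝ) j := by
        rw [Pi.single_apply]; split_ifs <;> norm_num
      have := mul_nonneg ht.le this
      simp only [Pi.sub_apply, Pi.smul_apply, smul_eq_mul, u₀]
      linarith
    have := hφ _ hm
    rw [map_sub, map_smul, smul_eq_mul, div_mul_cancel₀ _ hi.ne] at this
    linarith
  refine ⟨fun i => φ (Pi.single i 1), hpos, ?_, fun y hy => ?_⟩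
  · by_contra! h
    rw [hsum] at hneg
    simp [h] at hneg
  · refine le_of_forall_pos_le_add fun ε hε => ?_
    set T := ∑ i, φ (Pi.single i 1) with hT
    have hT0 : 0 ≤ T := Finset.sum_nonneg fun i _ => hpos i
    -- The shift by `ε / (T + 1)` changes `φ` by at most `ε`; the `+ 1` avoids division by zero.
    have hm : (fun i => f i y - ε / (T + 1)) ∈ S :=
      ⟨y, hy, fun i => by have : 0 < ε / (T + 1) := by positivity
                          linarith⟩
    have h1 := hφ _ hm
    rw [hsum] at h1
    simp only [mul_sub, Finset.sum_sub_distrib, ← Finset.sum_mul, ← hT] at h1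
    have : T * (ε / (T + 1)) ≤ ε := by
      rw [mul_div_assoc', div_le_iff₀ (by positivity)]
      nlinarith
    linarith

/-- From `x`, one can move slightly away from every point of `C` without leaving `C`. For convex
sets of a finite-dimensional space this characterizes the points of the relative interior. -/
def IsCorePoint (C : Set V) (x : V) : Prop :=
  x ∈ C ∧ ∀ y ∈ C, ∀ᶠ ε : ℝ in 𝓝[>] 0, x + ε • (x - y) ∈ C

theorem IsCorePoint.exists_combination {C : Set V} {x : V} (hx : IsCorePoint C x) {y : V}
    (hy : y ∈ C) : ∃ z ∈ C, ∃ a b : ℝ, 0 < a ∧ 0 < b ∧ a + b = 1 ∧ a • y + b • z = x := by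
  obtain ⟨ε, hε, h0⟩ := ((hx.2 y hy).and self_mem_nhdsWithin).exists
  have h0 : 0 < ε := h0
  refine ⟨_, hε, ε / (1 + ε), 1 / (1 + ε), by positivity, by positivity, by field_simp; ring, ?_⟩
  match_scalars <;> field_simp
  ring

theorem combination_eq {C : Set V} {h : V → ℝ} (hcc : ConcaveOn ℝ C h) (hcv : ConvexOn ℝ C h)
    {y z : V} (hy : y ∈ C) (hz : z ∈ C) {a b : ℝ} (ha : 0 ≤ a) (hb : 0 ≤ b) (hab : a + b = 1) :
    h (a • y + b • z) = a * h y + b * h z :=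
  le_antisymm (by simpa using hcv.2 hy hz ha hb hab) (by simpa using hcc.2 hy hz ha hb hab)

/-- A convex nonpositive function that vanishes at a core point vanishes identically. -/
theorem IsCorePoint.eq_zero_of_nonpos {C : Set V} {x : V} (hx : IsCorePoint C x) {h : V → ℝ}
    (hcv : ConvexOn ℝ C h) (h0 : h x = 0) (hle : ∀ y ∈ C, h y ≤ 0) {y : V} (hy : y ∈ C) :
    h y = 0 := by
  obtain ⟨z, hz, a, b, ha, hb, hab, rfl⟩ := hx.exists_combination hy
  have h1 := hcv.2 hy hz ha.le hb.le hab
  rw [h0, smul_eq_mul, smul_eq_mul] at h1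
  have h2 := mul_nonpos_of_nonneg_of_nonpos hb.le (hle z hz)
  have h3 := hle y hy
  by_contra hne
  have := mul_neg_of_pos_of_neg ha (lt_of_le_of_ne h3 hne)
  linarith

/-- Core points persist on the zero set of an affine function. -/
theorem IsCorePoint.inter_zero {C : Set V} {x : V} (hx : IsCorePoint C x) {h : V → ℝ}
    (hcc : ConcaveOn ℝ C h) (hcv : ConvexOn ℝ C h) (h0 : h x = 0) :
    IsCorePoint (C ∩ {y | h y = 0}) x := by
  refine ⟨⟨hx.1, h0⟩, fun y hy => ?_⟩
  filter_upwards [hx.2 y hy.1, self_mem_nhdsWithin] with ε hε hpos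
  have hpos : 0 < ε := hpos
  refine ⟨hε, ?_⟩
  have h1 := combination_eq hcc hcv hy.1 hε (a := ε / (1 + ε)) (b := 1 / (1 + ε)) (by positivity)
    (by positivity) (by field_simp; ring)
  have h2 : (ε / (1 + ε)) • y + (1 / (1 + ε)) • (x + ε • (x - y)) = x := by
    match_scalars <;> field_simp
    ring
  rw [h2, h0, show h y = 0 from hy.2, mul_zero, zero_add] at h1
  exact (mul_eq_zero.1 h1.symm).resolve_left (by positivity)

/-- Lagrange multiplier for one affine equality constraint. -/
theorem IsCorePoint.exists_equality_multiplier {C : Set V} {x : V} (hx : IsCorePoint C x)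
    (hC : Convex ℝ C) {h G : V → ℝ} (hcc : ConcaveOn ℝ C h) (hcv : ConvexOn ℝ C h) (h0 : h x = 0)
    (hG : ConcaveOn ℝ C G) {B : ℝ} (hB : ∀ y ∈ C, h y = 0 → G y ≤ B) :
    ∃ μ : ℝ, ∀ y ∈ C, G y + μ * h y ≤ B := by
  by_cases hP : ∃ y ∈ C, 0 < h y
  swap
  · push Not at hP
    exact ⟨0, fun y hy => by simpa using hB y hy (hx.eq_zero_of_nonpos hcv h0 hP hy)⟩
  by_cases hN : ∃ y ∈ C, h y < 0
  swap
  · push Not at hN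
    refine ⟨0, fun y hy => ?_⟩
    have := hx.eq_zero_of_nonpos hcc.neg (by simpa using h0) (fun y hy => by simpa using hN y hy) hy
    simpa using hB y hy (by simpa using this)
  obtain ⟨y₀, hy₀, hp₀⟩ := hP
  obtain ⟨z₀, hz₀, hn₀⟩ := hN
  -- The inequality `G y + μ * h y ≤ B` bounds `μ` above by `(B - G y) / h y` where `h y > 0` and
  -- below by it where `h y < 0`. The bounds are compatible: a segment between two such points
  -- crosses `h = 0`, where `G ≤ B`, and `G` is concave.
  obtain ⟨μ, hμ1, hμ2⟩ := exists_between_of_forall_le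
    (s := {r | ∃ z ∈ C, h z < 0 ∧ r = (B - G z) / h z})
    (t := {r | ∃ y ∈ C, 0 < h y ∧ r = (B - G y) / h y}) ⟨_, z₀, hz₀, hn₀, rfl⟩
    ⟨_, y₀, hy₀, hp₀, rfl⟩ (by
      rintro _ ⟨z, hz, hn, rfl⟩ _ ⟨y, hy, hp, rfl⟩
      rw [le_div_iff₀ hp, div_mul_eq_mul_div, div_le_iff_of_neg hn]
      have hd : 0 < h y - h z := by linarith
      have ha : 0 ≤ -h z / (h y - h z) := div_nonneg (by linarith) hd.le
      have hb : 0 ≤ h y / (h y - h z) := div_nonneg hp.le hd.le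
      have hab : -h z / (h y - h z) + h y / (h y - h z) = 1 := by field_simp; ring
      have h1 := hB _ (hC hy hz ha hb hab)
        (by rw [combination_eq hcc hcv hy hz ha hb hab]; field_simp; ring)
      have h2 := (hG.2 hy hz ha hb hab).trans h1
      simp only [smul_eq_mul] at h2
      rw [div_mul_eq_mul_div, div_mul_eq_mul_div, ← add_div, div_le_iff₀ hd] at h2
      linarith)
  refine ⟨μ, fun y hy => ?_⟩
  rcases lt_trichotomy (h y) 0 with hn | he | hp
  · have := hμ1 ⟨y, hy, hn, rfl⟩
    rw [div_le_iff_of_neg hn] at this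
    linarith
  · simpa [he] using hB y hy he
  · have := hμ2 ⟨y, hy, hp, rfl⟩
    rw [le_div_iff₀ hp] at this
    linarith

/-- The Fritz John form of the Lagrange multiplier theorem for concave programs. -/
theorem exists_fritzJohn_multipliers {ι : Type*} (s : Finset ι) {C : Set V} (hC : Convex ℝ C)
    (hne : C.Nonempty) {g : ι → V → ℝ} (hg : ∀ c ∈ s, ConcaveOn ℝ C (g c)) {F : V → ℝ}
    (hF : ConcaveOn ℝ C F) {B : ℝ} (hB : ∀ y ∈ C, (∀ c ∈ s, 0 ≤ g c y) → F y ≤ B) :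
    ∃ (θ : ℝ) (η : ι → ℝ), 0 ≤ θ ∧ (∀ c, 0 ≤ η c) ∧ (θ = 0 → ∃ c ∈ s, η c ≠ 0) ∧
      ∀ y ∈ C, θ * (F y - B) + ∑ c ∈ s, η c * g c y ≤ 0 := by
  classical
  -- `none` stands for the objective excess `F - B`, which cannot be positive at a feasible point.
  obtain ⟨θ, h0, hne, hle⟩ := exists_nonneg_combination_nonpos (ι := Option s) hne hC
    (f := fun o => o.elim (fun y => F y - B) fun c => g c)
    (by
      rintro (_ | c)
      · exact hF.sub (convexOn_const B hC)
      · exact hg c c.2)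
    (by
      rintro ⟨y, hy, h⟩
      have h1 := hB y hy fun c hc => (h (some ⟨c, hc⟩)).le
      have h2 := h none
      simp only [Option.elim_none] at h2
      linarith)
  refine ⟨θ none, fun c => if hc : c ∈ s then θ (some ⟨c, hc⟩) else 0, h0 _, fun c => ?_, fun h => ?_,
    fun y hy => ?_⟩
  · dsimp only
    split_ifs
    exacts [h0 _, le_rfl]
  · obtain ⟨_ | c, hc⟩ := hne
    · exact absurd h hc
    · exact ⟨c, c.2, by simpa using hc⟩
  · have := hle y hy
    rw [Fintype.sum_option] at this
    simp only [Option.elim_none, Option.elim_some] at this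
    rw [← Finset.sum_coe_sort s]
    simpa using this

/-- Lagrange multipliers for a concave program that satisfies Slater's condition at a core point,
where the constraints that are affine need only hold with a non-strict inequality. -/
theorem exists_lagrange_multipliers {ι : Type*} {g : ι → V → ℝ} {x : V} (s : Finset ι) :
    ∀ {C : Set V}, Convex ℝ C → IsCorePoint C x → (∀ c ∈ s, ConcaveOn ℝ C (g c)) →
    (∀ c ∈ s, 0 ≤ g c x ∧ (¬ ConvexOn ℝ C (g c) → 0 < g c x)) → ∀ {F : V → ℝ}, ConcaveOn ℝ C F →
    ∀ {B : ℝ}, (∀ y ∈ C, (∀ c ∈ s, 0 ≤ g c y) → F y ≤ B) →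
    ∃ μ : ι → ℝ, (∀ c ∈ s, 0 ≤ μ c) ∧ ∀ y ∈ C, F y + ∑ c ∈ s, μ c * g c y ≤ B := by
  classical
  induction s using Finset.strongInduction with
  | H s ih =>
    intro C hC hx hg hsl F hF B hB
    obtain ⟨θ, η, hθ, hη, hne, hle⟩ := exists_fritzJohn_multipliers s hC ⟨x, hx.1⟩ hg hF hB
    rcases hθ.eq_or_lt with rfl | hθ
    swap
    · refine ⟨fun c => η c / θ, fun c _ => div_nonneg (hη c) hθ.le, fun y hy => ?_⟩
      have h1 : ∑ c ∈ s, η c / θ * g c y = (∑ c ∈ s, η c * g c y) / θ := by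
        rw [Finset.sum_div]
        exact Finset.sum_congr rfl fun c _ => by ring
      have h2 : (∑ c ∈ s, η c * g c y) / θ ≤ B - F y := by
        rw [div_le_iff₀ hθ]
        have := hle y hy
        linarith
      rw [h1]
      linarith
    -- Degenerate case: the objective has weight zero. At `x` every weighted constraint vanishes, so
    -- by Slater's condition those with positive weight are both concave and convex.
    simp only [zero_mul, zero_add] at hle
    have hx0 : ∀ c ∈ s, η c * g c x = 0 := by
      have h1 : ∀ c ∈ s, 0 ≤ η c * g c x := fun c hc => mul_nonneg (hη c) (hsl c hc).1
      exact (Finset.sum_eq_zero_iff_of_nonneg h1).1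
        (le_antisymm (hle x hx.1) (Finset.sum_nonneg h1))
    have hcv : ∀ c ∈ s, η c ≠ 0 → g c x = 0 ∧ ConvexOn ℝ C (g c) := fun c hc h => by
      have := (mul_eq_zero.1 (hx0 c hc)).resolve_left h
      refine ⟨this, ?_⟩
      by_contra hn
      exact ((hsl c hc).2 hn).ne' this
    have hH : ∀ y ∈ C, ∑ c ∈ s, η c * g c y = 0 := fun y hy => by
      refine hx.eq_zero_of_nonpos (h := fun y => ∑ c ∈ s, η c * g c y) ?_
        (Finset.sum_eq_zero hx0) hle hy
      refine ⟨hC, fun u hu v hv a b ha hb hab => ?_⟩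
      simp only [smul_eq_mul, Finset.mul_sum, ← Finset.sum_add_distrib]
      refine Finset.sum_le_sum fun c hc => ?_
      by_cases h : η c = 0
      · simp [h]
      · have := mul_le_mul_of_nonneg_left ((hcv c hc h).2.2 hu hv ha hb hab) (hη c)
        simp only [smul_eq_mul] at this
        linarith
    obtain ⟨j, hj, hηj⟩ := hne rfl
    obtain ⟨hj0, hjcv⟩ := hcv j hj hηj
    have hηj : 0 < η j := lt_of_le_of_ne (hη j) hηj.symm
    have hsub : C ∩ {y | g j y = 0} ⊆ C := Set.inter_subset_left
    have hC' : Convex ℝ (C ∩ {y | g j y = 0}) := by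
      rintro u ⟨hu, hu0⟩ v ⟨hv, hv0⟩ a b ha hb hab
      refine ⟨hC hu hv ha hb hab, ?_⟩
      change g j _ = 0 at hu0 hv0 ⊢
      rw [combination_eq (hg j hj) hjcv hu hv ha hb hab, hu0, hv0]
      simp
    -- Where `∑ c ∈ s, η c * g c` vanishes, feasibility for all of `s` forces `g j = 0`. Constraint
    -- `j` can thus be moved into the domain, where `x` is still a core point.
    obtain ⟨μ', hμ', hle'⟩ := ih (s.erase j) (Finset.erase_ssubset hj) hC'
      (hx.inter_zero (hg j hj) hjcv hj0)
      (fun c hc => (hg c (Finset.mem_of_mem_erase hc)).subset hsub hC')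
      (fun c hc => ⟨(hsl c (Finset.mem_of_mem_erase hc)).1, fun h =>
        (hsl c (Finset.mem_of_mem_erase hc)).2 fun h' => h (h'.subset hsub hC')⟩)
      (hF.subset hsub hC') (B := B) (fun y hy h => hB y hy.1 fun c hc => by
        by_cases hcj : c = j
        · subst hcj
          exact hy.2.ge
        · exact h c (Finset.mem_erase.2 ⟨hcj, hc⟩))
    have hG : ConcaveOn ℝ C fun y => F y + ∑ c ∈ s.erase j, μ' c * g c y := by
      refine ⟨hC, fun u hu v hv a b ha hb hab => ?_⟩
      have h1 := hF.2 hu hv ha hb hab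
      have h2 : a * (∑ c ∈ s.erase j, μ' c * g c u) + b * (∑ c ∈ s.erase j, μ' c * g c v) ≤
          ∑ c ∈ s.erase j, μ' c * g c (a • u + b • v) := by
        rw [Finset.mul_sum, Finset.mul_sum, ← Finset.sum_add_distrib]
        refine Finset.sum_le_sum fun c hc => ?_
        have := mul_le_mul_of_nonneg_left
          ((hg c (Finset.mem_of_mem_erase hc)).2 hu hv ha hb hab) (hμ' c hc)
        simp only [smul_eq_mul] at this
        linarith
      simp only [smul_eq_mul] at h1 ⊢
      linarith
    obtain ⟨ν, hν⟩ := hx.exists_equality_multiplier hC (hg j hj) hjcv hj0 hG (B := B)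
      fun y hy h => hle' y ⟨hy, h⟩
    -- The equality multiplier `ν` may be negative. Adding `|ν| / η j` times the identically zero
    -- combination makes coefficient `j` equal to `ν + |ν|` and leaves the total unchanged.
    refine ⟨fun c => (if c = j then ν else μ' c) + |ν| / η j * η c, fun c hc => ?_,
      fun y hy => ?_⟩
    · by_cases hcj : c = j
      · subst hcj
        have := neg_abs_le ν
        simp only [if_true, div_mul_cancel₀ _ hηj.ne']
        linarith
      · simp only [if_neg hcj]
        exact add_nonneg (hμ' c (Finset.mem_erase.2 ⟨hcj, hc⟩))
          (mul_nonneg (div_nonneg (abs_nonneg _) hηj.le) (hη c))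
    · have h1 : ∑ c ∈ s, |ν| / η j * η c * g c y = 0 := by
        simp only [mul_assoc, ← Finset.mul_sum, hH y hy, mul_zero]
      have h2 : ∑ c ∈ s, (if c = j then ν else μ' c) * g c y =
          ν * g j y + ∑ c ∈ s.erase j, μ' c * g c y := by
        rw [← Finset.add_sum_erase s _ hj, if_pos rfl]
        congr 1
        exact Finset.sum_congr rfl fun c hc => by rw [if_neg (Finset.ne_of_mem_erase hc)]
      simp only [add_mul, Finset.sum_add_distrib, h1, h2]
      have := hν y hy
      linarith

/-- Finitely many coordinates share a common range of small `ε`. This supplies the Slater point for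
the program with copied variables. -/
theorem IsCorePoint.pi {κ : Type*} [Finite κ] {C : Set V} {x : V} (hx : IsCorePoint C x) :
    IsCorePoint (Set.univ.pi fun _ : κ => C) fun _ => x := by
  refine ⟨fun _ _ => hx.1, fun y hy => ?_⟩
  filter_upwards [eventually_all.2 fun k => hx.2 (y k) (hy k trivial)] with ε hε k _ using hε k

/-- The line through `y` and `x` stays in the affine span of `C`, where `C` is a neighbourhood of
`x`. -/
theorem isCorePoint_of_mem_intrinsicInterior {E : Type*} [NormedAddCommGroup E] [NormedSpace ℝ E]
    {C : Set E} {x : E} (hx : x ∈ intrinsicInterior ℝ C) : IsCorePoint C x := by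
  refine ⟨intrinsicInterior_subset hx, fun y hy => ?_⟩
  obtain ⟨x, hx', rfl⟩ := mem_intrinsicInterior.1 hx
  set γ : ℝ → affineSpan ℝ C := fun ε =>
    ⟨AffineMap.lineMap (x : E) y (-ε), AffineMap.lineMap_mem _ x.2 (subset_affineSpan ℝ C hy)⟩
  have hγ : Continuous γ := Continuous.subtype_mk (by fun_prop) _
  have h0 : γ 0 = x := by simp [γ]
  have h1 : ∀ᶠ ε in 𝓝 0, γ ε ∈ interior ((↑) ⁻¹' C : Set (affineSpan ℝ C)) :=
    hγ.continuousAt.eventually_mem (by rw [h0]; exact isOpen_interior.mem_nhds hx')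
  filter_upwards [nhdsWithin_le_nhds h1] with ε hε
  have h2 : γ ε ∈ ((↑) ⁻¹' C : Set (affineSpan ℝ C)) := interior_subset hε
  have h3 : (γ ε : E) = (x : E) + ε • ((x : E) - y) := by
    simp only [γ, AffineMap.lineMap_apply, vsub_eq_sub, vadd_eq_add]
    module
  rwa [Set.mem_preimage, h3] at h2

/-! ### Supergradients from multipliers of copied variables. -/

/-- The Karush-Kuhn-Tucker theorem in terms of superdifferentials, for a concave program on a
convex set of a Euclidean space that satisfies Slater's condition at a core point, where the
constraints that are affine need only hold with a non-strict inequality. -/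
theorem exists_superdifferential_multipliers {ι κ : Type*} [Fintype ι] [Fintype κ]
    {A : Set (EuclideanSpace ℝ ι)} (hA : Convex ℝ A) {x a : EuclideanSpace ℝ ι}
    (hx : IsCorePoint A x) (ha : a ∈ A) {F : EuclideanSpace ℝ ι → ℝ} (hF : ConcaveOn ℝ A F)
    {g : κ → EuclideanSpace ℝ ι → ℝ} (hg : ∀ c, ConcaveOn ℝ A (g c))
    (hsl : ∀ c, 0 ≤ g c x ∧ (¬ ConvexOn ℝ A (g c) → 0 < g c x)) (hfeas : ∀ c, 0 ≤ g c a)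
    (hmax : ∀ y ∈ A, (∀ c, 0 ≤ g c y) → F y ≤ F a) :
    ∃ (μ : κ → ℝ) (v : EuclideanSpace ℝ ι) (w : κ → EuclideanSpace ℝ ι),
      (∀ c, 0 ≤ μ c) ∧ (∀ c, μ c * g c a = 0) ∧ (∀ y ∈ A, F y ≤ F a + inner ℝ v (y - a)) ∧
      (∀ c, μ c ≠ 0 → ∀ y ∈ A, g c y ≤ g c a + inner ℝ (w c) (y - a)) ∧
      v + ∑ c, μ c • w c = 0 := by
  classical
  -- Give each constraint its own copy `z (some c)` of the variable, and require the copies to agree.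
  set P : Set (Option κ → EuclideanSpace ℝ ι) := Set.univ.pi fun _ => A with hPdef
  have hP : Convex ℝ P := convex_pi fun _ _ => hA
  have hproj {f : EuclideanSpace ℝ ι → ℝ} (hf : ConcaveOn ℝ A f) (o : Option κ) :
      ConcaveOn ℝ P fun z => f (z o) :=
    ⟨hP, fun u hu v hv _ _ ha hb hab => hf.2 (hu o trivial) (hv o trivial) ha hb hab⟩
  have hproj' {f : EuclideanSpace ℝ ι → ℝ} (hf : ConvexOn ℝ A f) (o : Option κ) :
      ConvexOn ℝ P fun z => f (z o) :=
    ⟨hP, fun u hu v hv _ _ ha hb hab => hf.2 (hu o trivial) (hv o trivial) ha hb hab⟩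
  -- Each coordinate of the agreement between copies is a pair of opposite affine inequalities. Both
  -- are equalities at the constant family `x`, which the weak Slater condition allows.
  set G : κ ⊕ (κ × ι) ⊕ (κ × ι) → (Option κ → EuclideanSpace ℝ ι) → ℝ :=
    Sum.elim (fun c z => g c (z (some c))) (Sum.elim (fun q z => z (some q.1) q.2 - z none q.2)
      fun q z => z none q.2 - z (some q.1) q.2) with hG
  obtain ⟨μ, hμ, hle⟩ := exists_lagrange_multipliers (g := G) Finset.univ hP hx.pi (by
      rintro (c | q | q) -
      · exact hproj (hg c) _
      · refine ⟨hP, fun u hu v hv _ _ ha hb hab => le_of_eq ?_⟩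
        simp [G]
        ring
      · refine ⟨hP, fun u hu v hv _ _ ha hb hab => le_of_eq ?_⟩
        simp [G]
        ring)
    (by
      rintro (c | q | q) -
      · exact ⟨(hsl c).1, fun h => (hsl c).2 fun h' => h (hproj' h' _)⟩
      · refine ⟨by simp [G], fun h => (h ⟨hP, fun u hu v hv _ _ ha hb hab => le_of_eq ?_⟩).elim⟩
        simp [G]
        ring
      · refine ⟨by simp [G], fun h => (h ⟨hP, fun u hu v hv _ _ ha hb hab => le_of_eq ?_⟩).elim⟩
        simp [G]
        ring)
    (hproj hF none) (B := F a) (by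
      intro z hz h
      have heq (c : κ) : z (some c) = z none := by
        ext k
        have h1 := h (.inr (.inl (c, k))) (Finset.mem_univ _)
        have h2 := h (.inr (.inr (c, k))) (Finset.mem_univ _)
        simp only [G, Sum.elim_inl, Sum.elim_inr] at h1 h2
        linarith
      refine hmax _ (hz none trivial) fun c => ?_
      have := h (.inl c) (Finset.mem_univ _)
      simpa [G, heq c] using this)
  set u : κ → EuclideanSpace ℝ ι := fun c =>
    WithLp.toLp 2 fun k => μ (.inr (.inl (c, k))) - μ (.inr (.inr (c, k))) with hu
  have hle' : ∀ z ∈ P, F (z none) + ∑ c, (μ (.inl c) * g c (z (some c)) +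
      inner ℝ (u c) (z (some c) - z none)) ≤ F a := fun z hz => by
    refine le_of_eq_of_le ?_ (hle z hz)
    simp only [Fintype.sum_sum_type, G, Sum.elim_inl, Sum.elim_inr, Finset.sum_add_distrib,
      Fintype.sum_prod_type]
    congr 2
    rw [← Finset.sum_add_distrib]
    refine Finset.sum_congr rfl fun c _ => ?_
    rw [← Finset.sum_add_distrib, PiLp.inner_apply]
    refine Finset.sum_congr rfl fun k _ => ?_
    simp [u]
    ring
  have hnonneg : ∀ c, 0 ≤ μ (.inl c) := fun c => hμ _ (Finset.mem_univ _)
  have hslack : ∀ c, μ (.inl c) * g c a = 0 := by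
    have h1 := hle' (fun _ => a) fun _ _ => ha
    simp only [sub_self, inner_zero_right, add_zero] at h1
    have h2 : ∀ c ∈ Finset.univ, 0 ≤ μ (.inl c) * g c a := fun c _ =>
      mul_nonneg (hnonneg c) (hfeas c)
    have h3 := (Finset.sum_eq_zero_iff_of_nonneg h2).1
      (le_antisymm (by linarith) (Finset.sum_nonneg h2))
    exact fun c => h3 c (Finset.mem_univ c)
  -- Only copy `c` moves away from `a`. If the multiplier is positive, `-u c` divided by it is a
  -- supergradient of `g c`; if it is zero, `u c` is an outward normal to `A` at `a`.
  have hcopy : ∀ c, ∀ y ∈ A, μ (.inl c) * g c y + inner ℝ (u c) (y - a) ≤ 0 := fun c y hy => by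
    have h1 := hle' (Function.update (fun _ => a) (some c) y) fun o _ => by
      by_cases ho : o = some c
      · subst ho
        simpa using hy
      · simpa [ho] using ha
    rw [Finset.sum_eq_single c] at h1
    · simp at h1
      linarith
    · intro c' _ hc'
      simp [hc', hslack]
    · simp
  have hmain : ∀ y ∈ A, F y ≤ F a + ∑ c, inner ℝ (u c) (y - a) := fun y hy => by
    have h1 := hle' (Function.update (fun _ => a) none y) fun o _ => by
      by_cases ho : o = none
      · subst ho
        simpa using hy
      · simpa [ho] using ha
    simp only [Function.update_self, ne_eq, reduceCtorEq, not_false_eq_true,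
      Function.update_of_ne, hslack, zero_add] at h1
    have h2 : ∑ c, inner ℝ (u c) (a - y) = -∑ c, inner ℝ (u c) (y - a) := by
      rw [← Finset.sum_neg_distrib]
      exact Finset.sum_congr rfl fun c _ => by rw [← inner_neg_right, neg_sub]
    linarith
  -- Normals belonging to zero multipliers are dropped from `v`: they contribute nonpositively on
  -- `A`, so the supergradient inequality for `F` survives.
  refine ⟨fun c => μ (.inl c), ∑ c, if μ (.inl c) = 0 then 0 else u c,
    fun c => -(μ (.inl c))⁻¹ • u c, hnonneg, hslack, fun y hy => ?_, fun c hc y hy => ?_, ?_⟩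
  · refine (hmain y hy).trans ?_
    rw [sum_inner]
    gcongr with c
    split_ifs with h
    · simpa [h] using hcopy c y hy
    · exact le_rfl
  · have hpos : 0 < μ (.inl c) := lt_of_le_of_ne (hnonneg c) (Ne.symm hc)
    have h1 := hcopy c y hy
    have h2 : g c a = 0 := (mul_eq_zero.1 (hslack c)).resolve_left hc
    rw [h2, inner_smul_left, zero_add]
    simp only [conj_trivial]
    rw [neg_mul, ← mul_neg, inv_mul_eq_div, le_div_iff₀ hpos]
    linarith
  · rw [← Finset.sum_add_distrib]
    refine Finset.sum_eq_zero fun c _ => ?_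
    split_ifs with h
    · simp [h]
    · rw [smul_smul, mul_neg, mul_inv_cancel₀ h]
      simp

end ConvexProgram

/-! ### Expectations along trajectories. -/

namespace MarkovPseudoGame

variable {n ℓ m : ℕ} {M : MarkovPseudoGame n ℓ m}

instance : IsMarkovKernel M.transition := M.transition_markov

instance (p : ∀ i, M.Policy i) (s : M.State) : IsProbabilityMeasure (trajectory p s) := by
  unfold trajectory
  infer_instance

/-- Separate continuity gives joint measurability, as for Carathéodory functions. -/
theorem measurable_reward (i : Fin n) :
    Measurable fun x : M.State × M.Profile => M.reward x.1 x.2 i :=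
  measurable_uncurry_of_continuous_of_measurable (u := fun s a => M.reward s a i)
    (fun a => M.reward_continuous_state a i) fun s => (M.reward_continuous_act s i).measurable

/-- Bounded measurable functions are integrable along a trajectory. -/
theorem integrable_trajectory (p : ∀ i, M.Policy i) (s : M.State) (t : ℕ)
    {F : M.State × M.Profile → ℝ} (hF : Measurable F) {B : ℝ} (hB : ∀ x, |F x| ≤ B) :
    Integrable (fun ω => F (ω t)) (trajectory p s) :=
  .of_bound (hF.comp (measurable_pi_apply t)).aestronglyMeasurable B
    (.of_forall fun ω => hB (ω t))

theorem abs_integral_le_of_abs_le {Ω : Type*} [MeasurableSpace Ω] (P : Measure Ω)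
    [IsProbabilityMeasure P] {f : Ω → ℝ} {B : ℝ} (hB : ∀ x, |f x| ≤ B) : |∫ x, f x ∂P| ≤ B := by
  simpa using norm_integral_le_of_norm_le_const (μ := P) (f := f) (C := B) (.of_forall hB)

theorem integral_trajectory_zero (p : ∀ i, M.Policy i) (s : M.State)
    {F : M.State × M.Profile → ℝ} (hF : Measurable F) :
    ∫ ω, F (ω 0) ∂(trajectory p s) = F (s, play p 0 (Fin.elim0, s)) := by
  have h := Kernel.traj_map_frestrictLe_apply (X := fun _ => M.State × M.Profile)
    (κ := stepKernel p) 0 0 (fun _ => (s, play p 0 (Fin.elim0, s)))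
  rw [Kernel.partialTraj_self, Kernel.id_apply] at h
  have h' : Measurable fun x : Finset.Iic 0 → M.State × M.Profile =>
      F (x ⟨0, Finset.mem_Iic.2 le_rfl⟩) := hF.comp (measurable_pi_apply _)
  have := integral_map (μ := trajectory p s) (φ := Preorder.frestrictLe 0)
    (Preorder.measurable_frestrictLe 0).aemeasurable h'.aestronglyMeasurable
  rw [trajectory, h, integral_dirac' _ _ h'.stronglyMeasurable] at this
  exact this.symm

theorem integral_stepKernel (p : ∀ i, M.Policy i) (t : ℕ) (h : Finset.Iic t → M.State × M.Profile)
    {F : M.State × M.Profile → ℝ} (hF : Measurable F) :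
    ∫ x, F x ∂(stepKernel p t h) = ∫ y, F (y, play p (t + 1) (extendHistory t (h, y)))
      ∂(M.transition (h ⟨t, Finset.mem_Iic.2 le_rfl⟩)) := by
  have hm : Measurable fun x : (Finset.Iic t → M.State × M.Profile) × M.State =>
      (x.2, play p (t + 1) (extendHistory t x)) :=
    measurable_snd.prodMk ((measurable_play p (t + 1)).comp (measurable_extendHistory t))
  have hFm : Measurable fun x : (Finset.Iic t → M.State × M.Profile) × M.State =>
      F (x.2, play p (t + 1) (extendHistory t x)) := hF.comp hm
  rw [stepKernel, Kernel.map_apply _ hm, integral_map hm.aemeasurable hF.aestronglyMeasurable,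
    Kernel.prod_apply, Kernel.id_apply, Kernel.comap_apply, Measure.dirac_prod,
    integral_map measurable_prodMk_left.aemeasurable hFm.aestronglyMeasurable]

/-- The joint law of the path up to time `t` and the next pair is the law of the path composed with
`stepKernel`; Fubini then integrates out the next pair. -/
theorem integral_trajectory_succ (p : ∀ i, M.Policy i) (s : M.State) (t : ℕ)
    {F : M.State × M.Profile → ℝ} (hF : Measurable F) {B : ℝ} (hB : ∀ x, |F x| ≤ B) :
    ∫ ω, F (ω (t + 1)) ∂(trajectory p s) = ∫ ω, ∫ y, F (y, play p (t + 1)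
      (extendHistory t (fun k => ω k, y))) ∂(M.transition (ω t)) ∂(trajectory p s) := by
  set x₀ : Finset.Iic 0 → M.State × M.Profile := fun _ => (s, play p 0 (Fin.elim0, s)) with hx₀
  have h := Kernel.partialTraj_compProd_eq_map_traj (X := fun _ => M.State × M.Profile)
    (κ := stepKernel p) (a := 0) (b := t) (Nat.zero_le t) (x₀ := x₀)
  have hF2 : Measurable fun z : (Finset.Iic t → M.State × M.Profile) × (M.State × M.Profile) =>
      F z.2 := hF.comp measurable_snd
  have h1 := integral_map (μ := trajectory p s)
    (φ := fun ω => (Preorder.frestrictLe (π := fun _ => M.State × M.Profile) t ω, ω (t + 1)))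
    ((Preorder.measurable_frestrictLe t).prodMk (measurable_pi_apply _)).aemeasurable
    hF2.aestronglyMeasurable
  rw [trajectory, ← hx₀, ← h, Measure.integral_compProd (.of_bound hF2.aestronglyMeasurable B
    (.of_forall fun z => hB z.2)), ← Kernel.traj_map_frestrictLe_apply,
    integral_map (Preorder.measurable_frestrictLe t).aemeasurable
    (hF2.stronglyMeasurable.integral_kernel_prod_right' (κ := stepKernel p t)).aestronglyMeasurable]
    at h1
  rw [trajectory, ← hx₀]
  refine h1.symm.trans (integral_congr_ae (.of_forall fun ω => ?_))
  exact integral_stepKernel p t _ hF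

/-- A function that is nonpositive at all pairs that can occur at time `t` has a nonpositive
expectation at time `t`. -/
theorem integral_trajectory_nonpos (p : ∀ i, M.Policy i) (s : M.State) (t : ℕ)
    {F : M.State × M.Profile → ℝ} (hF : Measurable F) {B : ℝ} (hB : ∀ x, |F x| ≤ B)
    (hle : ∀ h : M.History t, F (h.2, play p t h) ≤ 0) : ∫ ω, F (ω t) ∂(trajectory p s) ≤ 0 := by
  cases t with
  | zero =>
    rw [integral_trajectory_zero p s hF]
    exact hle (Fin.elim0, s)
  | succ t =>
    rw [integral_trajectory_succ p s t hF hB]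
    exact integral_nonpos fun ω => integral_nonpos fun y => hle (extendHistory t (fun k => ω k, y))

theorem integral_trajectory_eq_zero (p : ∀ i, M.Policy i) (s : M.State) (t : ℕ)
    {F : M.State × M.Profile → ℝ} (hF : Measurable F) {B : ℝ} (hB : ∀ x, |F x| ≤ B)
    (h0 : ∀ h : M.History t, F (h.2, play p t h) = 0) : ∫ ω, F (ω t) ∂(trajectory p s) = 0 := by
  refine le_antisymm (integral_trajectory_nonpos p s t hF hB fun h => (h0 h).le) ?_
  have := integral_trajectory_nonpos p s t hF.neg (B := B) (by simpa using hB)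
    fun h => by simp [h0 h]
  simp only [Pi.neg_apply, integral_neg] at this
  linarith

theorem measurable_transition_integral {U : M.State → ℝ} (hU : Measurable U) :
    Measurable fun x => ∫ y, U y ∂(M.transition x) :=
  (hU.stronglyMeasurable.comp_measurable measurable_snd |>.integral_kernel_prod_right'
    (κ := M.transition)).measurable

theorem integral_trajectory_state_succ (p : ∀ i, M.Policy i) (s : M.State) (t : ℕ)
    {U : M.State → ℝ} (hU : Measurable U) {B : ℝ} (hB : ∀ x, |U x| ≤ B) :
    ∫ ω, U (ω (t + 1)).1 ∂(trajectory p s) =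
      ∫ ω, ∫ y, U y ∂(M.transition (ω t)) ∂(trajectory p s) :=
  integral_trajectory_succ p s t (F := fun x => U x.1) (hU.comp measurable_fst) fun x => hB x.1

/-- The terms are dominated by a geometric series, so sum and expectation commute. -/
theorem hasSum_discount_mul_integral (p : ∀ i, M.Policy i) (s : M.State)
    {F : M.State × M.Profile → ℝ} (hF : Measurable F) {B : ℝ} (hB : ∀ x, |F x| ≤ B) :
    HasSum (fun t => M.discount ^ t * ∫ ω, F (ω t) ∂(trajectory p s))
      (∫ ω, ∑' t : ℕ, M.discount ^ t * F (ω t) ∂(trajectory p s)) := by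
  have hγ := M.discount_pos.le
  have h := hasSum_integral_of_summable_integral_norm (μ := trajectory p s)
    (F := fun t ω => M.discount ^ t * F (ω t))
    (fun t => (integrable_trajectory p s t hF hB).const_mul _)
    (.of_nonneg_of_le (fun t => integral_nonneg fun ω => norm_nonneg _) (fun t => ?_)
      ((summable_geometric_of_lt_one hγ M.discount_lt_one).mul_right B))
  · simpa only [integral_const_mul] using h
  · refine (le_abs_self _).trans (abs_integral_le_of_abs_le _ fun ω => ?_)
    rw [abs_norm, norm_mul, norm_pow, Real.norm_of_nonneg hγ]
    exact mul_le_mul_of_nonneg_left (hB _) (pow_nonneg hγ t)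

theorem hasSum_value (p : ∀ i, M.Policy i) (i : Fin n) (s : M.State) :
    HasSum (fun t => M.discount ^ t * ∫ ω, M.reward (ω t).1 (ω t).2 i ∂(trajectory p s))
      (value p i s) := by
  obtain ⟨B, hB⟩ := M.reward_bounded
  exact hasSum_discount_mul_integral p s (measurable_reward i) fun x => hB x.1 x.2 i

theorem exists_abs_value_le (p : ∀ i, M.Policy i) (i : Fin n) : ∃ B, ∀ s, |value p i s| ≤ B := by
  obtain ⟨B, hB⟩ := M.reward_bounded
  have hγ := M.discount_pos.le
  refine ⟨∑' t, M.discount ^ t * B, fun s => ?_⟩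
  rw [← (hasSum_value p i s).tsum_eq, ← Real.norm_eq_abs]
  refine tsum_of_norm_bounded
    ((summable_geometric_of_lt_one hγ M.discount_lt_one).mul_right B).hasSum fun t => ?_
  rw [norm_mul, norm_pow, Real.norm_of_nonneg hγ]
  exact mul_le_mul_of_nonneg_left (abs_integral_le_of_abs_le _ fun ω => hB _ _ _) (pow_nonneg hγ t)

theorem measurable_integral_trajectory (p : ∀ i, M.Policy i) (t : ℕ)
    {F : M.State × M.Profile → ℝ} (hF : Measurable F) :
    Measurable fun s => ∫ ω, F (ω t) ∂(trajectory p s) := by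
  have hm : Measurable fun s : M.State => (fun _ => (s, play p 0 (Fin.elim0, s)) :
      Finset.Iic 0 → M.State × M.Profile) :=
    measurable_pi_lambda _ fun _ => measurable_id.prodMk
      ((measurable_play p 0).comp (measurable_const.prodMk measurable_id))
  have hF' : StronglyMeasurable fun z : (Finset.Iic 0 → M.State × M.Profile) ×
      (ℕ → M.State × M.Profile) => F (z.2 t) :=
    (hF.comp ((measurable_pi_apply t).comp measurable_snd)).stronglyMeasurable
  exact (hF'.integral_kernel_prod_right'
    (κ := Kernel.traj (X := fun _ => M.State × M.Profile) (stepKernel p) 0)).measurable.comp hm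

theorem measurable_value (p : ∀ i, M.Policy i) (i : Fin n) : Measurable (value p i) :=
  measurable_of_tendsto_metrizable
    (f := fun T s => ∑ t ∈ Finset.range T,
      M.discount ^ t * ∫ ω, M.reward (ω t).1 (ω t).2 i ∂(trajectory p s))
    (fun _ => Finset.measurable_fun_sum _ fun t _ =>
      (measurable_integral_trajectory p t (measurable_reward i)).const_mul _)
    (tendsto_pi_nhds.2 fun s => (hasSum_value p i s).tendsto_sum_nat)

theorem measurable_actionValue (p : ∀ i, M.Policy i) (i : Fin n) :
    Measurable fun x : M.State × M.Profile => actionValue p i x.1 x.2 :=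
  (measurable_reward i).add ((measurable_transition_integral (measurable_value p i)).const_mul _)

theorem exists_abs_actionValue_le (p : ∀ i, M.Policy i) (i : Fin n) :
    ∃ B, ∀ s a, |actionValue p i s a| ≤ B := by
  obtain ⟨B, hB⟩ := M.reward_bounded
  obtain ⟨B', hB'⟩ := exists_abs_value_le p i
  refine ⟨B + M.discount * B', fun s a => (abs_add_le _ _).trans (add_le_add (hB _ _ _) ?_)⟩
  rw [abs_mul, abs_of_pos M.discount_pos]
  exact mul_le_mul_of_nonneg_left (abs_integral_le_of_abs_le _ hB') M.discount_pos.le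

theorem measurable_markovPlay (p : ∀ i, M.MarkovPolicy i) : Measurable (markovPlay p) :=
  measurable_pi_lambda _ fun i => (p i).measurable_act

/-! ### The Bellman equation and the advantage formula. -/

/-- Under a Markov policy profile, what happens from time `1` on is what happens from time `0` on
when play starts at the second state. -/
theorem integral_trajectory_shift (p : ∀ i, M.MarkovPolicy i) (t : ℕ) :
    ∀ {U : M.State → ℝ}, Measurable U → ∀ {B : ℝ}, (∀ x, |U x| ≤ B) → ∀ s : M.State,
      ∫ ω, U (ω (t + 1)).1 ∂(trajectory (markovProfile p) s) =
        ∫ y, ∫ ω, U (ω t).1 ∂(trajectory (markovProfile p) y)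
          ∂(M.transition (s, markovPlay p s)) := by
  induction t with
  | zero =>
    intro U hU B hB s
    rw [integral_trajectory_state_succ _ s 0 hU hB,
      integral_trajectory_zero _ s (measurable_transition_integral hU)]
    simp only [integral_trajectory_zero _ _ (F := fun x => U x.1) (hU.comp measurable_fst)]
    rfl
  | succ t ih =>
    intro U hU B hB s
    -- Actions that occur are those of `markovPlay`, so one step acts on `U` through a transition
    -- operator on states. The induction hypothesis is then applied to the image of `U`.
    have hstep (t : ℕ) (s : M.State) : ∫ ω, U (ω (t + 1)).1 ∂(trajectory (markovProfile p) s) =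
        ∫ ω, ∫ y, U y ∂(M.transition ((ω t).1, markovPlay p (ω t).1))
          ∂(trajectory (markovProfile p) s) := by
      rw [integral_trajectory_state_succ _ s t hU hB, ← sub_eq_zero, ← integral_sub]
      · refine integral_trajectory_eq_zero _ s t (F := fun x => ∫ y, U y ∂(M.transition x) -
          ∫ y, U y ∂(M.transition (x.1, markovPlay p x.1))) ?_ (B := B + B) (fun x => ?_)
          fun h => sub_self _
        · exact (measurable_transition_integral hU).sub ((measurable_transition_integral hU).comp
            (measurable_fst.prodMk ((measurable_markovPlay p).comp measurable_fst)))
        · exact (abs_sub _ _).trans (add_le_add (abs_integral_le_of_abs_le _ hB)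
            (abs_integral_le_of_abs_le _ hB))
      · exact integrable_trajectory _ s t (measurable_transition_integral hU)
          fun x => abs_integral_le_of_abs_le _ hB
      · exact integrable_trajectory _ s t (F := fun x =>
          ∫ y, U y ∂(M.transition (x.1, markovPlay p x.1)))
          ((measurable_transition_integral hU).comp
            (measurable_fst.prodMk ((measurable_markovPlay p).comp measurable_fst)))
          fun x => abs_integral_le_of_abs_le _ hB
    rw [hstep]
    simp only [hstep t]
    exact ih ((measurable_transition_integral hU).comp
      (measurable_id.prodMk (measurable_markovPlay p))) (fun x => abs_integral_le_of_abs_le _ hB) s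

/-- The Bellman equation of a Markov policy profile. -/
theorem value_markovProfile (p : ∀ i, M.MarkovPolicy i) (i : Fin n) (s : M.State) :
    value (markovProfile p) i s = actionValue (markovProfile p) i s (markovPlay p s) := by
  obtain ⟨B, hB⟩ := M.reward_bounded
  have hγ := M.discount_pos.le
  set R : M.State → ℝ := fun x => M.reward x (markovPlay p x) i with hR
  have hRm : Measurable R :=
    (measurable_reward i).comp (measurable_id.prodMk (measurable_markovPlay p))
  have hRB : ∀ x, |R x| ≤ B := fun x => hB _ _ _
  have hreward (t : ℕ) (x : M.State) :
      ∫ ω, M.reward (ω t).1 (ω t).2 i ∂(trajectory (markovProfile p) x) =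
        ∫ ω, R (ω t).1 ∂(trajectory (markovProfile p) x) := by
    rw [← sub_eq_zero, ← integral_sub]
    · exact integral_trajectory_eq_zero _ x t (F := fun z => M.reward z.1 z.2 i - R z.1)
        ((measurable_reward i).sub (hRm.comp measurable_fst)) (B := B + B)
        (fun z => (abs_sub _ _).trans (add_le_add (hB _ _ _) (hRB _))) fun h => sub_self _
    · exact integrable_trajectory _ x t (measurable_reward i) fun z => hB _ _ _
    · exact integrable_trajectory _ x t (F := fun z => R z.1) (hRm.comp measurable_fst)
        fun z => hRB _
  have hV (x : M.State) : HasSum (fun t => M.discount ^ t *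
      ∫ ω, R (ω t).1 ∂(trajectory (markovProfile p) x)) (value (markovProfile p) i x) := by
    simpa only [hreward] using hasSum_value (markovProfile p) i x
  have hbound (t : ℕ) (x : M.State) :
      |∫ ω, R (ω t).1 ∂(trajectory (markovProfile p) x)| ≤ B :=
    abs_integral_le_of_abs_le _ fun ω => hRB _
  have hint := hasSum_integral_of_summable_integral_norm
    (μ := M.transition (s, markovPlay p s))
    (F := fun t x => M.discount ^ t * ∫ ω, R (ω t).1 ∂(trajectory (markovProfile p) x))
    (fun t => (Integrable.of_bound (measurable_integral_trajectory _ t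
      (F := fun z => R z.1) (hRm.comp measurable_fst)).aestronglyMeasurable B
      (.of_forall (hbound t))).const_mul _)
    (.of_nonneg_of_le (fun t => integral_nonneg fun x => norm_nonneg _) (fun t =>
      (le_abs_self _).trans (abs_integral_le_of_abs_le _ fun x => by
        rw [abs_norm, norm_mul, norm_pow, Real.norm_of_nonneg hγ]
        exact mul_le_mul_of_nonneg_left (hbound t x) (pow_nonneg hγ t)))
      ((summable_geometric_of_lt_one hγ M.discount_lt_one).mul_right B))
  simp only [integral_const_mul, (hV _).tsum_eq, ← integral_trajectory_shift p _ hRm hRB] at hint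
  -- The series without its time-zero term is also the discounted expected continuation value;
  -- uniqueness of sums equates the two.
  have h1 := (hasSum_nat_add_iff' 1).2 (hV s)
  have h2 := hint.mul_left M.discount
  simp only [← mul_assoc, ← pow_succ'] at h2
  have h3 := h1.unique h2
  have h4 := integral_trajectory_zero (markovProfile p) s (F := fun z => R z.1)
    (hRm.comp measurable_fst)
  simp only [Finset.sum_range_one, pow_zero, one_mul] at h3
  rw [h4] at h3
  rw [actionValue, ← h3]
  simp [R]

/-- The gain from a change of policies is the expected discounted sum of the advantages of the
actions that are played. -/
theorem hasSum_advantage (p q : ∀ i, M.Policy i) (i : Fin n) (s : M.State) :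
    HasSum (fun t => M.discount ^ t *
      ∫ ω, (actionValue p i (ω t).1 (ω t).2 - value p i (ω t).1) ∂(trajectory q s))
      (value q i s - value p i s) := by
  obtain ⟨B, hB⟩ := M.reward_bounded
  obtain ⟨B', hB'⟩ := exists_abs_value_le p i
  have hVm := measurable_value p i
  have hu := (hasSum_discount_mul_integral q s (F := fun x => value p i x.1)
    (hVm.comp measurable_fst) fun x => hB' x.1)
  have hu' := (hasSum_nat_add_iff' 1).2 hu
  -- The discounted series of `value p i` from time `1` minus that from time `0` telescopes to
  -- `-value p i s`.
  have h := ((hasSum_value q i s).add hu').sub hu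
  have h0 := integral_trajectory_zero q s (F := fun x => value p i x.1) (hVm.comp measurable_fst)
  simp only [Finset.sum_range_one, pow_zero, one_mul, h0] at h
  have hterm (t : ℕ) : M.discount ^ t *
      ∫ ω, (actionValue p i (ω t).1 (ω t).2 - value p i (ω t).1) ∂(trajectory q s) =
      M.discount ^ t * ∫ ω, M.reward (ω t).1 (ω t).2 i ∂(trajectory q s) +
        M.discount ^ (t + 1) * ∫ ω, value p i (ω (t + 1)).1 ∂(trajectory q s) -
        M.discount ^ t * ∫ ω, value p i (ω t).1 ∂(trajectory q s) := by
    rw [integral_trajectory_state_succ q s t hVm hB']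
    have h1 := integrable_trajectory q s t (measurable_reward i) fun x => hB x.1 x.2 i
    have h2 := integrable_trajectory q s t (measurable_transition_integral hVm)
      fun x => abs_integral_le_of_abs_le _ hB'
    have h3 := integrable_trajectory q s t (F := fun x => value p i x.1)
      (hVm.comp measurable_fst) fun x => hB' x.1
    have h4 := integral_sub (f := fun ω => M.reward (ω t).1 (ω t).2 i +
      M.discount * ∫ y, value p i y ∂(M.transition (ω t))) (h1.add (h2.const_mul _)) h3
    rw [integral_add h1 (h2.const_mul _), integral_const_mul] at h4
    simp only [actionValue, Prod.mk.eta]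
    rw [h4]
    ring
  rw [funext hterm]
  rwa [add_sub_assoc, sub_right_comm, sub_self, zero_sub, ← sub_eq_add_neg] at h

end MarkovPseudoGame

/-! ### One-shot deviations and sufficiency. -/

namespace MarkovPseudoGame

variable {n ℓ m d : ℕ} {M : MarkovPseudoGame n ℓ m}

/-- However `q` depends on the past, the opponents react only to the current state. Hence every
deviation reduces to one-shot comparisons at states. -/
theorem play_update_markovProfile (p : ∀ i, M.MarkovPolicy i) (i : Fin n) (q : M.Policy i) (τ : ℕ)
    (h : M.History τ) : play (Function.update (markovProfile p) i q) τ h =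
      Function.update (markovPlay p h.2) i (q.act τ h) := by
  funext j
  by_cases hj : j = i
  · subst hj
    simp [play]
  · simp [play, hj, markovPlay, markovProfile, MarkovPolicy.toPolicy]

theorem update_markovPlay_self (p : ∀ i, M.MarkovPolicy i) (i : Fin n) (s : M.State) :
    Function.update (markovPlay p s) i ((p i).act s) = markovPlay p s :=
  Function.update_eq_self i (markovPlay p s)

theorem measurable_advantage (p : ∀ i, M.Policy i) (i : Fin n) :
    Measurable fun x : M.State × M.Profile => actionValue p i x.1 x.2 - value p i x.1 :=
  (measurable_actionValue p i).sub ((measurable_value p i).comp measurable_fst)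

theorem exists_abs_advantage_le (p : ∀ i, M.Policy i) (i : Fin n) :
    ∃ B, ∀ x : M.State × M.Profile, |actionValue p i x.1 x.2 - value p i x.1| ≤ B := by
  obtain ⟨B, hB⟩ := exists_abs_actionValue_le p i
  obtain ⟨B', hB'⟩ := exists_abs_value_le p i
  exact ⟨B + B', fun x => (abs_sub _ _).trans (add_le_add (hB _ _) (hB' _))⟩

/-- The one-shot deviation principle: a feasible Markov policy profile is a generalized Markov
perfect equilibrium if and only if every player's action maximizes the action value among the
feasible actions. -/
theorem isGMPE_iff_actionValue_le {p : ∀ i, M.MarkovPolicy i} (hp : IsFeasibleMarkov p) :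
    IsGMPE p ↔ ∀ (i : Fin n) (s : M.State), ∀ x ∈ M.feasible i s (M.others i (markovPlay p s)),
      actionValue (markovProfile p) i s (Function.update (markovPlay p s) i x) ≤
        actionValue (markovProfile p) i s (markovPlay p s) := by
  constructor
  · rintro ⟨-, hV⟩ i s x hx
    classical
    -- The deviation plays `x` only at time `0` in state `s`, so all later advantages vanish by the
    -- Bellman equation and the total gain is the single advantage of `x`.
    set q : M.Policy i :=
      { act := fun τ h => if τ = 0 ∧ h.2 = s then x else (p i).act h.2
        measurable_act := fun τ => Measurable.ite
          ((MeasurableSet.const _).inter (measurable_snd (measurableSet_singleton s)))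
          measurable_const ((p i).measurable_act.comp measurable_snd) } with hq
    have hfeas : IsFeasiblePolicy (markovProfile p) i q := by
      intro τ h
      change (if τ = 0 ∧ h.2 = s then x else (p i).act h.2) ∈
        M.feasible i h.2 (M.others i (markovPlay p h.2))
      split_ifs with hc
      · rw [hc.2]
        exact hx
      · exact hp i h.2
    have hle := hV i s q hfeas
    have hsum := hasSum_advantage (markovProfile p) (Function.update (markovProfile p) i q) i s
    obtain ⟨B, hB⟩ := exists_abs_advantage_le (markovProfile p) i
    have hm := measurable_advantage (markovProfile p) i
    have hone := hasSum_single 0 (f := fun t => M.discount ^ t *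
      ∫ ω, (actionValue (markovProfile p) i (ω t).1 (ω t).2 - value (markovProfile p) i (ω t).1)
        ∂(trajectory (Function.update (markovProfile p) i q) s)) fun t ht => by
      refine mul_eq_zero_of_right _ (integral_trajectory_eq_zero _ s t (F := fun x =>
        actionValue (markovProfile p) i x.1 x.2 - value (markovProfile p) i x.1) hm hB fun h => ?_)
      have : q.act t h = (p i).act h.2 := if_neg fun hc => ht hc.1
      simp only [play_update_markovProfile, this, update_markovPlay_self, value_markovProfile,
        sub_self]
    have heq := hsum.unique hone
    have h0 := integral_trajectory_zero (Function.update (markovProfile p) i q) s hm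
    rw [play_update_markovProfile] at h0
    have hqx : q.act 0 (Fin.elim0, s) = x := if_pos ⟨rfl, rfl⟩
    simp only [pow_zero, one_mul, hqx] at heq h0
    rw [h0] at heq
    rw [← value_markovProfile p i s]
    linarith
  · refine fun hQ => ⟨hp, fun i s q hq => ?_⟩
    obtain ⟨B, hB⟩ := exists_abs_advantage_le (markovProfile p) i
    have hsum := hasSum_advantage (markovProfile p) (Function.update (markovProfile p) i q) i s
    refine sub_nonpos.1 (hsum.nonpos fun t => ?_)
    refine mul_nonpos_of_nonneg_of_nonpos (pow_nonneg M.discount_pos.le t)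
      (integral_trajectory_nonpos _ s t (F := fun x =>
        actionValue (markovProfile p) i x.1 x.2 - value (markovProfile p) i x.1)
        (measurable_advantage _ i) hB fun h => ?_)
    rw [play_update_markovProfile, sub_nonpos, value_markovProfile]
    exact hQ i h.2 _ (hq t h)

/-- The first-order conditions with complementary slackness are sufficient for optimality. -/
theorem Stationary.actionValue_le {g : Fin n → Fin d → M.State → M.Profile → ℝ}
    {p : ∀ i, M.MarkovPolicy i} {i : Fin n} {s : M.State} {μ : Fin d → ℝ≥0}
    (h : Stationary g p i s μ) (hslack : ∀ c, (μ c : ℝ) * g i c s (markovPlay p s) = 0)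
    {x : M.Act i} (hx : ∀ c, 0 ≤ slice i (markovPlay p s) (g i c s) x) :
    actionValue (markovProfile p) i s (Function.update (markovPlay p s) i x) ≤
      actionValue (markovProfile p) i s (markovPlay p s) := by
  obtain ⟨v, w, hv, hw, hsum⟩ := h
  have h1 := hv x
  simp only [slice, update_markovPlay_self] at h1
  refine h1.trans (add_le_of_nonpos_right ?_)
  -- A constraint with nonzero multiplier is active, so its supergradient inequality gives `0 ≤ g i
  -- c s ≤ inner ℝ (w c) (x - a)` with `g` evaluated at the deviation `x` and `a` the current
  -- action.
  rw [eq_neg_of_add_eq_zero_left hsum, inner_neg_left, sum_inner, neg_nonpos]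
  refine Finset.sum_nonneg fun c _ => ?_
  rw [real_inner_smul_left]
  by_cases hc : μ c = 0
  · simp [hc]
  · have h2 := hw c hc x
    have h3 : g i c s (markovPlay p s) = 0 :=
      (mul_eq_zero.1 (hslack c)).resolve_left (by exact_mod_cast hc)
    simp only [slice, update_markovPlay_self, h3, zero_add] at h2
    exact mul_nonneg (μ c).2 ((hx c).trans h2)

end MarkovPseudoGame

/-! ### Necessity of the first-order conditions. -/

section Concave

theorem extend_subtype_val {E : Type*} {K : Set E} (f : K → ℝ) (x : K) :
    Function.extend Subtype.val f 0 (x : E) = f x :=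
  Subtype.val_injective.extend_apply f 0 x

/-- By contraposition, a constraint that is not convex is not affine, so Slater's condition makes it
strict, as the multiplier theorem requires. -/
theorem IsAffine.convexOn_extend {E : Type*} [NormedAddCommGroup E] [InnerProductSpace ℝ E]
    {K : Set E} (hK : Convex ℝ K) {f : K → ℝ} (hf : IsAffine f) :
    ConvexOn ℝ K (Function.extend Subtype.val f 0) := by
  obtain ⟨v, b, hf⟩ := hf
  refine ⟨hK, fun x hx y hy α β hα hβ hαβ => le_of_eq ?_⟩
  rw [extend_subtype_val f ⟨_, hK hx hy hα hβ hαβ⟩, extend_subtype_val f ⟨x, hx⟩,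
    extend_subtype_val f ⟨y, hy⟩, hf, hf, hf]
  simp only [inner_add_right, real_inner_smul_right, smul_eq_mul]
  linear_combination (-b) * hαβ

end Concave

namespace MarkovPseudoGame

variable {n ℓ m d : ℕ} {M : MarkovPseudoGame n ℓ m}

/-- Under Slater's condition, an optimal action satisfies the first-order conditions. -/
theorem exists_stationary {g : Fin n → Fin d → M.State → M.Profile → ℝ}
    (hg : M.ConcaveConstraints g) {p : ∀ i, M.MarkovPolicy i} (hQ : ConcaveActionValue p)
    (hsl : SlaterCondition g p) (i : Fin n) (s : M.State)
    (hfeas : ∀ c, 0 ≤ g i c s (markovPlay p s))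
    (hmax : ∀ x : M.Act i, (∀ c, 0 ≤ slice i (markovPlay p s) (g i c s) x) →
      actionValue (markovProfile p) i s (Function.update (markovPlay p s) i x) ≤
        actionValue (markovProfile p) i s (markovPlay p s)) :
    ∃ μ : Fin d → ℝ≥0, Stationary g p i s μ ∧
      ∀ c, (μ c : ℝ) * g i c s (markovPlay p s) = 0 := by
  -- Convexity is taken from the action value, since there may be no constraints (`d = 0`).
  have hK : Convex ℝ (M.Act i) := (hQ i s).1
  obtain ⟨x, hx, hxc⟩ := hsl i s
  have hself (F : M.Profile → ℝ) :
      slice i (markovPlay p s) F ((p i).act s) = F (markovPlay p s) := by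
    rw [slice, update_markovPlay_self]
  obtain ⟨μ, v, w, hμ, hslack, hv, hw, hsum⟩ := exists_superdifferential_multipliers hK
    (isCorePoint_of_mem_intrinsicInterior hx) ((p i).act s).2 (hQ i s)
    (g := fun c => Function.extend Subtype.val (slice i (markovPlay p s) (g i c s)) 0)
    (fun c => (hg i s (markovPlay p s)).2 c)
    (fun c => by
      rw [extend_subtype_val]
      exact ⟨(hxc c).1, fun h => (hxc c).2 fun h' => h (h'.convexOn_extend hK)⟩)
    (fun c => by
      rw [extend_subtype_val, hself]
      exact hfeas c)
    (fun y hy h => by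
      rw [extend_subtype_val _ ⟨y, hy⟩, extend_subtype_val, hself]
      refine hmax ⟨y, hy⟩ fun c => ?_
      have := h c
      rwa [extend_subtype_val _ ⟨y, hy⟩] at this)
  refine ⟨fun c => ⟨μ c, hμ c⟩, ⟨v, w, fun y => ?_, fun c hc y => ?_, hsum⟩, fun c => ?_⟩
  · have := hv y y.2
    rwa [extend_subtype_val, extend_subtype_val] at this
  · have := hw c (fun h => hc (NNReal.eq h)) y y.2
    rwa [extend_subtype_val, extend_subtype_val] at this
  · have := hslack c
    rwa [extend_subtype_val, hself] at this

end MarkovPseudoGame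

theorem mainTheorem7 {n ℓ m d : ℕ} (M : MarkovPseudoGame n ℓ m)
    (g : Fin n → Fin d → M.State → M.Profile → ℝ) (hg : M.ConcaveConstraints g)
    (p : ∀ i, M.MarkovPolicy i) (hp : MarkovPseudoGame.IsFeasibleMarkov p) :
    ((∃ μ : M.State → Fin n → Fin d → ℝ≥0, MarkovPseudoGame.SolvesKKTBellman g p μ) →
      MarkovPseudoGame.IsGMPE p) ∧
    (MarkovPseudoGame.ConcaveActionValue p → MarkovPseudoGame.SlaterCondition g p →
      (MarkovPseudoGame.IsGMPE p ↔
        ∃ μ : M.State → Fin n → Fin d → ℝ≥0, MarkovPseudoGame.SolvesKKTBellman g p μ)) := by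
  have hmem (i : Fin n) (s : M.State) (x : M.Act i) :
      x ∈ M.feasible i s (M.others i (MarkovPseudoGame.markovPlay p s)) ↔
        ∀ c, 0 ≤ MarkovPseudoGame.slice i (MarkovPseudoGame.markovPlay p s) (g i c s) x := by
    rw [(hg i s _).1]
    rfl
  have hsuff : (∃ μ : M.State → Fin n → Fin d → ℝ≥0, MarkovPseudoGame.SolvesKKTBellman g p μ) →
      MarkovPseudoGame.IsGMPE p := by
    rintro ⟨μ, hμ⟩
    refine (MarkovPseudoGame.isGMPE_iff_actionValue_le hp).2 fun i s x hx => ?_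
    exact (hμ i s).1.actionValue_le (hμ i s).2.1 ((hmem i s x).1 hx)
  refine ⟨hsuff, fun hQ hsl => ⟨fun h => ?_, hsuff⟩⟩
  have hopt := (MarkovPseudoGame.isGMPE_iff_actionValue_le hp).1 h
  have hfeas (i : Fin n) (s : M.State) (c : Fin d) :
      0 ≤ g i c s (MarkovPseudoGame.markovPlay p s) := by
    have := (hmem i s _).1 (hp i s) c
    rwa [MarkovPseudoGame.slice, MarkovPseudoGame.update_markovPlay_self] at this
  -- The multipliers are chosen state by state; no measurability in the state is demanded of them.
  choose μ hμ using fun (s : M.State) (i : Fin n) => MarkovPseudoGame.exists_stationary hg hQ hsl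
    i s (hfeas i s) fun x hx => hopt i s x ((hmem i s x).2 hx)
  exact ⟨μ, fun i s => ⟨(hμ s i).1, (hμ s i).2, hfeas i s,
    MarkovPseudoGame.value_markovProfile p i s⟩⟩
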